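/- Let $G=(V,E)$ be a finite undirected graph and $T\subseteq V$ a set of terminals. A biset is a pair $\hat X=(X,X^+)$ with $X\subseteq X^+\subseteq V$; let $\mathcal V$ be the family of bisets with $X\neq\emptyset$, and let $\mathcal C$ be the family of those $\hat X\in\mathcal V$ for which $X\cap T=X^+\cap T=\{t\}$ for some $t\in T$. Let $\delta(\hat X)$ denote the set of edges with one end node in $X$ and the other in $V\setminus X^+$, and write $x(E')=\sum_{e\in E'}x(e)$ for $E' \subseteq E$. For $h\colon\mathcal V\to\mathbb R$ and $u\colon E\to\mathbb Z_{\ge 0}$ let $$P(h,u)=\{x\in\mathbb Q_{\ge 0}^E : x(\delta(\hat X))\ge h(\hat X)\ \text{for all } \hat X\in\mathcal V,\ x(e)\le u(e)\ \text{for all } e\in E\},$$ and for $y\colon E\to\mathbb Q_{\ge 0}$ let $h_{y}(\hat X)=h(\hat X)-y(\delta(\hat X))$. The function $h$ is called skew supermodular if, for all $\hat X,\hat Y\in\mathcal V$ with $h(\hat X)>0$ and $h(\hat Y)>0$, at least one of $$h(\hat X)+h(\hat Y)\le h(\hat X\cap\hat Y)+h(\hat X\cup\hat Y),\qquad h(\hat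 X)+h(\hat Y)\le h(\hat X\setminus\hat Y)+h(\hat Y\setminus\hat X)$$ holds, where $\hat X\cap\hat Y=(X\cap Y,X^+\cap Y^+)$, $\hat X\cup\hat Y=(X\cup Y,X^+\cup Y^+)$, $\hat X\setminus\hat Y=(X\setminus Y^+,X^+\setminus Y)$, and the value of $h$ at a biset with empty inner part is taken to be $0$. Suppose that $h$ is skew supermodular and that $h(\hat X)>0$ only if $\hat X\in\mathcal C$, and let $u\colon E\to\mathbb Z_{\ge 0}$. For every extreme point $x$ of $P(h,u)$, with $\lfloor x\rfloor$ denoting the componentwise floor of $x$, the vector $x-\lfloor x\rfloor$ is an extreme point of $P(h_{\lfloor x\rfloor},\mathbf 1)$, where $\mathbf 1$ is the all-one vector. Moreover, if $h$ is integer-valued, then every extreme point $x$ of $P(h,u)$ is half-integral, i.e. $2x(e)\in\mathbb Z$ for all $e\in E$. -/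

import Mathlib

/-- A biset on `V`: an ordered pair of node sets, the inner part being contained in the
outer part. -/
@[ext]
structure Biset (V : Type*) where
  inner : Finset V
  outer : Finset V
  inner_subset_outer : inner ⊆ outer

namespace Biset

variable {V : Type*} [DecidableEq V]

/-- `X ∩ Y = (X ∩ Y, X⁺ ∩ Y⁺)`. -/
def inter (X Y : Biset V) : Biset V where
  inner := X.inner ∩ Y.inner
  outer := X.outer ∩ Y.outer
  inner_subset_outer :=
    Finset.inter_subset_inter X.inner_subset_outer Y.inner_subset_outer

/-- `X ∪ Y = (X ∪ Y, X⁺ ∪ Y⁺)`. -/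
def union (X Y : Biset V) : Biset V where
  inner := X.inner ∪ Y.inner
  outer := X.outer ∪ Y.outer
  inner_subset_outer :=
    Finset.union_subset_union X.inner_subset_outer Y.inner_subset_outer

/-- `X \ Y = (X \ Y⁺, X⁺ \ Y)`. -/
def diff (X Y : Biset V) : Biset V where
  inner := X.inner \ Y.outer
  outer := X.outer \ Y.inner
  inner_subset_outer :=
    Finset.sdiff_subset_sdiff X.inner_subset_outer Y.inner_subset_outer

end Biset

/-- The family `𝒱` of all bisets on `V` with nonempty inner part. -/
abbrev NonemptyBiset (V : Type*) : Type _ := {X : Biset V // X.inner.Nonempty}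

/-- A (real-valued) biset function is defined on the bisets with nonempty inner part. -/
abbrev BisetFunction (V : Type*) : Type _ := NonemptyBiset V → ℝ

namespace BisetFunction

variable {V : Type*} [DecidableEq V]

/-- The value of a biset function on an arbitrary biset, with the usual convention that it is `0`
when the inner part is empty (such bisets may arise as `X ∩ Y`, `X \ Y` or `Y \ X`). -/
def value (h : BisetFunction V) (X : Biset V) : ℝ :=
  if hX : X.inner.Nonempty then h ⟨X, hX⟩ else 0

/-- (Positive) skew supermodularity. -/
def SkewSupermodular (h : BisetFunction V) : Prop :=
  ∀ X Y : NonemptyBiset V, 0 < h X → 0 < h Y →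
    h X + h Y ≤ h.value (X.1.inter Y.1) + h.value (X.1.union Y.1) ∨
    h X + h Y ≤ h.value (X.1.diff Y.1) + h.value (Y.1.diff X.1)

/-- Every value of `h` is an integer. -/
def IntegerValued (h : BisetFunction V) : Prop :=
  ∀ X : NonemptyBiset V, ∃ z : ℤ, h X = z

end BisetFunction

section Graph

variable {V E : Type*} [DecidableEq V] [Fintype E]

/-- The family `𝒞(t)` of the bisets `X` (with nonempty inner part) such that
`X ∩ T = X⁺ ∩ T = {t}`. -/
def terminalBisetsAt (T : Finset V) (t : V) : Set (NonemptyBiset V) :=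
  {X | X.1.inner ∩ T = {t} ∧ X.1.outer ∩ T = {t}}

/-- The family `𝒞`, the union of the families `𝒞(t)` over the terminals `t ∈ T`. -/
def terminalBisets (T : Finset V) : Set (NonemptyBiset V) :=
  ⋃ t ∈ T, terminalBisetsAt T t

open Classical in
/-- In the undirected (multi)graph with node set `V`, edge set `E` and end nodes `ends e` of the
edge `e`: the set `δ(X)` of edges with one end node in `X` and the other in `V \ X⁺`. -/
noncomputable def bisetCut (ends : E → Sym2 V) (X : Biset V) : Finset E :=
  Finset.univ.filter fun e => ∃ a b : V, ends e = s(a, b) ∧ a ∈ X.inner ∧ b ∉ X.outer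

/-- The polyhedron `P(h, u)`: all nonnegative rational vectors `x` with `x(δ(X)) ≥ h(X)` for all
bisets `X` with nonempty inner part, and `x(e) ≤ u(e)` for all edges `e`. -/
def coverPolyhedron (ends : E → Sym2 V) (h : BisetFunction V) (u : E → ℕ) : Set (E → ℚ) :=
  {x | (∀ e, 0 ≤ x e) ∧
    (∀ X : NonemptyBiset V, h X ≤ ((∑ e ∈ bisetCut ends X.1, x e : ℚ) : ℝ)) ∧
    ∀ e, x e ≤ u e}

/-- The residual biset function `h_x`, `h_x(X) = h(X) - x(δ(X))`. -/
noncomputable def residualFunction (ends : E → Sym2 V) (h : BisetFunction V) (x : E → ℚ) :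
    BisetFunction V :=
  fun X => h X - ((∑ e ∈ bisetCut ends X.1, x e : ℚ) : ℝ)

end Graph

/-!
The bisets with positive demand each contain exactly one terminal, so two of them that cross can be
uncrossed: with `X ∩ Y`, `X ∪ Y` if they share the terminal, with `X \ Y`, `Y \ X` otherwise. Hence
the constraints tight at an extreme point `x` are generated, up to the bounds on the variables, by
those of a maximal non-crossing family `L` of tight bisets, and these determine `x` on the set `F`
of edges with a fractional value. Replace the incidence vector of each `δ(X)`, `X ∈ L`, by its
difference with the one of the predecessor of `X`, the largest member of `L` properly inside `X`.
In the resulting `0, ±1` matrix a column has at most two nonzero entries, as each end node of an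
edge accounts for at most one change. When `h` is integer-valued, a nonzero row of the restriction
to `F` has at least two nonzero entries, a single one being impossible for an integral equation in
fractional variables; since there are at least `|F|` nonzero rows, each has exactly two. An equation
`± x(e) ± x(f) ∈ ℤ` is turned into `± φ(x(e)) ± φ(x(f)) = 0` by every odd function `φ` of period
`1`, so `φ ∘ x` lies in the kernel and vanishes on `F`. For `φ` with zeros only at half-integers,
this is half-integrality.

For the fractional part of `x`, translation by `⌊x⌋` carries the residual polyhedron back to the
original one, except possibly for the upper bounds at edges where `x` is integral, and on those the
points of any segment around `x - ⌊x⌋` vanish.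
-/

open scoped Finset Matrix Topology

section HalfIntegralSystems

theorem signType_cast_mem_int {R : Type*} [Ring R] (s : SignType) :
    (s : R) ∈ (Int.castRingHom R).range :=
  ⟨s, by cases s <;> simp⟩

variable {m n R : Type*} [Fintype n] [CommRing R]

theorem mulVec_apply_eq_sum_support [DecidableEq R] (A : Matrix m n R) (x : n → R)
    (i : m) :
    A.mulVec x i = ∑ j with A i j ≠ 0, A i j * x j :=
  (Finset.sum_filter_of_ne fun _ _ => left_ne_zero_of_mul).symm

theorem two_le_card_support_row [DecidableEq R] {A : Matrix m n R}
    (hA : ∀ i j, A i j ∈ Set.range SignType.cast) {x : n → R}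
    (hx : ∀ j, x j ∉ (Int.castRingHom R).range) {i : m}
    (hint : A.mulVec x i ∈ (Int.castRingHom R).range) (hi : A i ≠ 0) :
    2 ≤ #{j | A i j ≠ 0} := by
  by_contra! hlt
  obtain ⟨f, hf⟩ := Function.ne_iff.1 hi
  have hsupp : ({j | A i j ≠ 0} : Finset n) = {f} :=
    Finset.eq_singleton_iff_unique_mem.2 ⟨Finset.mem_filter.2 ⟨Finset.mem_univ f, hf⟩,
      fun j hj => Finset.card_le_one.1 (Nat.le_of_lt_succ hlt) j hj f
        (Finset.mem_filter.2 ⟨Finset.mem_univ f, hf⟩)⟩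
  rw [mulVec_apply_eq_sum_support, hsupp, Finset.sum_singleton] at hint
  obtain ⟨s, hs⟩ := hA i f
  rw [← hs] at hf hint
  cases s
  · exact hf SignType.coe_zero
  · rw [SignType.neg_eq_neg_one, SignType.coe_neg_one, neg_one_mul, neg_mem_iff] at hint
    exact hx f hint
  · rw [SignType.pos_eq_one, SignType.coe_one, one_mul] at hint
    exact hx f hint

variable [Fintype m]

theorem card_le_card_rows_ne_zero [Nontrivial R] {A : Matrix m n R}
    [DecidablePred fun i => A i ≠ 0] (hA : Function.Injective A.mulVec) :
    Fintype.card n ≤ #{i | A i ≠ 0} := by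
  let B : Matrix {i // A i ≠ 0} n R := A.submatrix Subtype.val id
  have hB : Function.Injective B.mulVecLin := by
    intro v w hvw
    refine hA (funext fun i => ?_)
    by_cases hi : A i = 0
    · simp only [Matrix.mulVec, hi, zero_dotProduct]
    · exact congrFun hvw ⟨i, hi⟩
  simpa only [Fintype.card_subtype] using card_le_of_injective R B.mulVecLin hB

/-- The `k * #n` nonzero entries that the columns allow are all used up by the at least `#n`
nonzero rows. -/
theorem card_support_row_eq_of_injective [Nontrivial R] [DecidableEq R]
    {A : Matrix m n R} {k : ℕ} (hA : Function.Injective A.mulVec)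
    (hcol : ∀ j, #{i | A i j ≠ 0} ≤ k) (hrow : ∀ i, A i ≠ 0 → k ≤ #{j | A i j ≠ 0})
    {i : m} (hi : A i ≠ 0) : #{j | A i j ≠ 0} = k := by
  classical
  have hrows : ∀ i ∈ ({i | A i ≠ 0} : Finset m), k ≤ #{j | A i j ≠ 0} :=
    fun i hi => hrow i (Finset.mem_filter.1 hi).2
  have hle : ∑ i with A i ≠ 0, #{j | A i j ≠ 0} ≤ ∑ i with A i ≠ 0, k :=
    calc ∑ i with A i ≠ 0, #{j | A i j ≠ 0}
      _ ≤ ∑ i, #{j | A i j ≠ 0} := Finset.sum_le_univ_sum_of_nonneg fun _ => Nat.zero_le _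
      _ = ∑ j, #{i | A i j ≠ 0} := by
        simp only [Finset.card_filter, Finset.sum_comm (s := .univ (α := m))]
      _ ≤ ∑ _j : n, k := Finset.sum_le_sum fun j _ => hcol j
      _ ≤ ∑ i with A i ≠ 0, k := by
        simpa only [Finset.sum_const, Finset.card_univ, smul_eq_mul] using
          Nat.mul_le_mul_right k (card_le_card_rows_ne_zero hA)
  have heq := (Finset.sum_eq_sum_iff_of_le hrows).1 (le_antisymm (Finset.sum_le_sum hrows) hle)
  exact (heq i (Finset.mem_filter.2 ⟨Finset.mem_univ i, hi⟩)).symm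

variable {K : Type*} [Field K] [LinearOrder K] [IsStrictOrderedRing K] [FloorRing K]

/-- An odd function of period `1` whose zeros are exactly the half-integers. -/
def fractAsymmetry (q : K) : K :=
  Int.fract q - Int.fract (-q)

theorem fractAsymmetry_signType_mul (s : SignType) (q : K) :
    fractAsymmetry (s * q) = s * fractAsymmetry q := by
  cases s <;> simp [fractAsymmetry]

theorem fractAsymmetry_intCast_sub (k : ℤ) (q : K) :
    fractAsymmetry (k - q) = -fractAsymmetry q := by
  have hneg : -((k : K) - q) = q + ((-k : ℤ) : K) := by push_cast; ring
  rw [fractAsymmetry, fractAsymmetry, hneg, Int.fract_add_intCast, sub_eq_add_neg (k : K),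
    Int.fract_intCast_add, neg_sub]

theorem exists_eq_div_two_of_fractAsymmetry_eq_zero {q : K} (hq : fractAsymmetry q = 0) :
    ∃ k : ℤ, q = k / 2 := by
  refine ⟨⌊q⌋ - ⌊-q⌋, ?_⟩
  unfold fractAsymmetry Int.fract at hq
  push_cast
  linarith

theorem signType_mul_fractAsymmetry_add_eq_zero {s t : SignType} {p q : K} {k : ℤ}
    (h : s * p + t * q = k) : s * fractAsymmetry p + t * fractAsymmetry q = 0 := by
  rw [← fractAsymmetry_signType_mul, ← fractAsymmetry_signType_mul, eq_sub_of_add_eq h,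
    fractAsymmetry_intCast_sub, neg_add_cancel]

theorem exists_eq_div_two_of_forall_notMem_int {A : Matrix m n K}
    (hA : ∀ i j, A i j ∈ Set.range SignType.cast) (hcol : ∀ j, #{i | A i j ≠ 0} ≤ 2)
    (hinj : Function.Injective A.mulVec) {x : n → K} (hx : ∀ j, x j ∉ (Int.castRingHom K).range)
    (hint : ∀ i, A.mulVec x i ∈ (Int.castRingHom K).range) (j : n) :
    ∃ k : ℤ, x j = k / 2 := by
  classical
  have hker : A.mulVec (fractAsymmetry ∘ x) = 0 := by
    ext i
    rw [Pi.zero_apply]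
    by_cases hi : A i = 0
    · simp only [Matrix.mulVec, hi, zero_dotProduct]
    obtain ⟨f, g, hfg, hsupp⟩ := Finset.card_eq_two.1 <| card_support_row_eq_of_injective hinj hcol
      (fun i => two_le_card_support_row hA hx (hint i)) hi
    obtain ⟨s, hs⟩ := hA i f
    obtain ⟨t, ht⟩ := hA i g
    obtain ⟨k, hk⟩ := hint i
    rw [mulVec_apply_eq_sum_support, hsupp, Finset.sum_pair hfg, ← hs, ← ht] at hk ⊢
    exact signType_mul_fractAsymmetry_add_eq_zero hk.symm
  have hzero : fractAsymmetry ∘ x = 0 := hinj (hker.trans (Matrix.mulVec_zero A).symm)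
  exact exists_eq_div_two_of_fractAsymmetry_eq_zero (congrFun hzero j)

theorem exists_eq_div_two_of_integral_system {A : Matrix m n K}
    (hA : ∀ i j, A i j ∈ Set.range SignType.cast) (hcol : ∀ j, #{i | A i j ≠ 0} ≤ 2) {x : n → K}
    (hint : ∀ i, A.mulVec x i ∈ (Int.castRingHom K).range)
    (hdet : ∀ z : n → K, (∀ j, x j ∈ (Int.castRingHom K).range → z j = 0) →
      A.mulVec z = 0 → z = 0) (j : n) :
    ∃ k : ℤ, x j = k / 2 := by
  classical
  let F : Set n := {j | x j ∉ (Int.castRingHom K).range}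
  by_cases hj : j ∈ F
  swap
  · obtain ⟨k, hk⟩ := not_not.1 hj
    exact ⟨2 * k, by rw [← hk]; simp⟩
  let B : Matrix m F K := A.submatrix id Subtype.val
  have hsplit (z : n → K) (i : m) :
      A.mulVec z i = B.mulVec (z ∘ Subtype.val) i + ∑ j : {j // j ∉ F}, A i j * z j :=
    (Fintype.sum_subtype_add_sum_subtype (· ∈ F) fun j => A i j * z j).symm
  refine exists_eq_div_two_of_forall_notMem_int (A := B) (x := x ∘ Subtype.val)
    (fun i j => hA i j) (fun j => hcol j) ?_ (fun j => j.2) (fun i => ?_) ⟨j, hj⟩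
  · refine (injective_iff_map_eq_zero B.mulVecLin).2 fun z hz => ?_
    let w : n → K := Function.extend Subtype.val z 0
    have hwF : w ∘ Subtype.val = z := Function.extend_comp Subtype.val_injective z 0
    have hw0 (j : n) (hj : j ∉ F) : w j = 0 :=
      Function.extend_apply' z (0 : n → K) j (by rintro ⟨f, rfl⟩; exact hj f.2)
    have hw : w = 0 := hdet w (fun j hj => hw0 j (not_not.2 hj)) <| funext fun i => by
      rw [hsplit, hwF, Finset.sum_eq_zero fun j _ => by rw [hw0 j j.2, mul_zero], add_zero]
      exact congrFun hz i
    rw [← hwF, hw]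
    rfl
  · rw [← sub_eq_of_eq_add (hsplit x i)]
    refine sub_mem (hint i) (sum_mem fun j _ => mul_mem ?_ (not_not.1 j.2))
    obtain ⟨s, hs⟩ := hA i j
    exact hs ▸ signType_cast_mem_int s

end HalfIntegralSystems

namespace Biset

section Order

variable {V : Type*}

instance : PartialOrder (Biset V) :=
  PartialOrder.lift (fun X => (X.inner, X.outer)) fun _ _ h =>
    Biset.ext (congrArg Prod.fst h) (congrArg Prod.snd h)

instance : OrderBot (Biset V) where
  bot := ⟨∅, ∅, subset_rfl⟩
  bot_le X := ⟨X.inner.empty_subset, X.outer.empty_subset⟩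

instance [Finite V] : Finite (Biset V) :=
  Finite.of_injective (fun X : Biset V => (X.inner, X.outer)) fun _ _ h =>
    Biset.ext (congrArg Prod.fst h) (congrArg Prod.snd h)

instance [DecidableEq V] : Lattice (Biset V) where
  sup := union
  inf := inter
  le_sup_left _ _ := ⟨Finset.subset_union_left, Finset.subset_union_left⟩
  le_sup_right _ _ := ⟨Finset.subset_union_right, Finset.subset_union_right⟩
  sup_le _ _ _ hX hY := ⟨Finset.union_subset hX.1 hY.1, Finset.union_subset hX.2 hY.2⟩
  inf_le_left _ _ := ⟨Finset.inter_subset_left, Finset.inter_subset_left⟩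
  inf_le_right _ _ := ⟨Finset.inter_subset_right, Finset.inter_subset_right⟩
  le_inf _ _ _ hY hZ := ⟨Finset.subset_inter hY.1 hZ.1, Finset.subset_inter hY.2 hZ.2⟩

theorem inner_bot : (⊥ : Biset V).inner = ∅ := rfl

variable [DecidableEq V] (X Y : Biset V)

theorem inner_inf : (X ⊓ Y).inner = X.inner ∩ Y.inner := rfl

theorem outer_inf : (X ⊓ Y).outer = X.outer ∩ Y.outer := rfl

theorem inner_sup : (X ⊔ Y).inner = X.inner ∪ Y.inner := rfl

theorem outer_sup : (X ⊔ Y).outer = X.outer ∪ Y.outer := rfl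

end Order

section NonCrossing

variable {V : Type*} {X Y Z : Biset V} {a : V}

/-- Two bisets are strongly disjoint if each inner part is disjoint from the other outer part,
equivalently if `X \ Y = X` and `Y \ X = Y`. -/
def StronglyDisjoint (X Y : Biset V) : Prop :=
  Disjoint X.inner Y.outer ∧ Disjoint X.outer Y.inner

/-- Two bisets do not cross if they are comparable or strongly disjoint. Families of pairwise
non-crossing bisets take the place of laminar set families. -/
def NonCrossing (X Y : Biset V) : Prop :=
  X ≤ Y ∨ Y ≤ X ∨ X.StronglyDisjoint Y

theorem StronglyDisjoint.symm (h : X.StronglyDisjoint Y) : Y.StronglyDisjoint X :=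
  ⟨h.2.symm, h.1.symm⟩

theorem StronglyDisjoint.mono_right (h : Z.StronglyDisjoint X) (hYX : Y ≤ X) :
    Z.StronglyDisjoint Y :=
  ⟨h.1.mono_right hYX.2, h.2.mono_right hYX.1⟩

theorem NonCrossing.of_le (h : X ≤ Y) : X.NonCrossing Y :=
  Or.inl h

theorem NonCrossing.of_ge (h : Y ≤ X) : X.NonCrossing Y :=
  Or.inr (Or.inl h)

theorem StronglyDisjoint.nonCrossing (h : X.StronglyDisjoint Y) : X.NonCrossing Y :=
  Or.inr (Or.inr h)

instance : Std.Refl (NonCrossing (V := V)) :=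
  ⟨fun _ => .of_le le_rfl⟩

instance : Std.Symm (NonCrossing (V := V)) where
  symm _ _ := Or.rec .of_ge (Or.rec .of_le fun h => h.symm.nonCrossing)

theorem NonCrossing.symm (h : X.NonCrossing Y) : Y.NonCrossing X :=
  Std.Symm.symm X Y h

theorem NonCrossing.le_or_le_of_mem (h : X.NonCrossing Y) (hX : a ∈ X.outer) (hY : a ∈ Y.inner) :
    X ≤ Y ∨ Y ≤ X := by
  rcases h with h | h | h
  · exact Or.inl h
  · exact Or.inr h
  · exact absurd hY (Finset.disjoint_left.1 h.2 hX)

variable [DecidableEq V]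

theorem StronglyDisjoint.sup_right (hX : Z.StronglyDisjoint X) (hY : Z.StronglyDisjoint Y) :
    Z.StronglyDisjoint (X ⊔ Y) :=
  ⟨Finset.disjoint_union_right.2 ⟨hX.1, hY.1⟩, Finset.disjoint_union_right.2 ⟨hX.2, hY.2⟩⟩

theorem diff_le_left : X.diff Y ≤ X :=
  ⟨Finset.sdiff_subset, Finset.sdiff_subset⟩

theorem stronglyDisjoint_diff : Y.StronglyDisjoint (X.diff Y) :=
  ⟨Finset.disjoint_sdiff, Finset.disjoint_sdiff⟩

theorem StronglyDisjoint.le_diff (hZY : Z.StronglyDisjoint Y) (hZX : Z ≤ X) : Z ≤ X.diff Y :=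
  ⟨Finset.subset_sdiff.2 ⟨hZX.1, hZY.1⟩, Finset.subset_sdiff.2 ⟨hZX.2, hZY.2⟩⟩

end NonCrossing

section Terminals

variable {V : Type*} {X Y Z : Biset V} {T : Finset V} {r s t : V}

/-- The biset belongs to `𝒞(t)`. Since `X ⊆ X⁺`, the two conditions `X ∩ T = {t}` and
`X⁺ ∩ T = {t}` amount to the following membership conditions. -/
structure HasUniqueTerminal (X : Biset V) (T : Finset V) (t : V) : Prop where
  mem_terminals : t ∈ T
  mem_inner : t ∈ X.inner
  eq_of_mem_outer : ∀ s ∈ T, s ∈ X.outer → s = t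

namespace HasUniqueTerminal

theorem mem_outer (hX : X.HasUniqueTerminal T t) : t ∈ X.outer :=
  X.inner_subset_outer hX.mem_inner

theorem eq_of_mem_inner (hX : X.HasUniqueTerminal T t) (hs : s ∈ T) (hsX : s ∈ X.inner) : s = t :=
  hX.eq_of_mem_outer s hs (X.inner_subset_outer hsX)

theorem eq_of_le (hX : X.HasUniqueTerminal T s) (hY : Y.HasUniqueTerminal T t) (hXY : X ≤ Y) :
    s = t :=
  hY.eq_of_mem_outer s hX.mem_terminals (hXY.2 hX.mem_outer)

theorem le_or_le (hX : X.HasUniqueTerminal T t) (hY : Y.HasUniqueTerminal T t)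
    (h : X.NonCrossing Y) : X ≤ Y ∨ Y ≤ X :=
  h.le_or_le_of_mem hX.mem_outer hY.mem_inner

theorem stronglyDisjoint (hX : X.HasUniqueTerminal T s) (hY : Y.HasUniqueTerminal T t)
    (hst : s ≠ t) (h : X.NonCrossing Y) : X.StronglyDisjoint Y :=
  (h.resolve_left fun hle => hst (hX.eq_of_le hY hle)).resolve_left
    fun hle => hst (hY.eq_of_le hX hle).symm

variable [DecidableEq V]

theorem not_diff (hX : X.HasUniqueTerminal T t) (hY : Y.HasUniqueTerminal T t) :
    ¬ (X.diff Y).HasUniqueTerminal T r := by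
  intro hr
  obtain ⟨hrX, hrY⟩ := Finset.mem_sdiff.1 hr.mem_inner
  exact hrY (hX.eq_of_mem_inner hr.mem_terminals hrX ▸ hY.mem_outer)

theorem not_inf (hX : X.HasUniqueTerminal T s) (hY : Y.HasUniqueTerminal T t) (hst : s ≠ t) :
    ¬ (X ⊓ Y).HasUniqueTerminal T r := fun hr =>
  hst ((hr.eq_of_le hX inf_le_left).symm.trans (hr.eq_of_le hY inf_le_right))

theorem not_sup (hX : X.HasUniqueTerminal T s) (hY : Y.HasUniqueTerminal T t) (hst : s ≠ t) :
    ¬ (X ⊔ Y).HasUniqueTerminal T r := fun hr =>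
  hst ((hX.eq_of_le hr le_sup_left).trans (hY.eq_of_le hr le_sup_right).symm)

theorem nonCrossing_inf_and_sup (hZ : Z.HasUniqueTerminal T r) (hX : X.HasUniqueTerminal T t)
    (hY : Y.HasUniqueTerminal T t) (hXY : ¬ X.NonCrossing Y) (hZX : Z.NonCrossing X)
    (hZY : Z.NonCrossing Y) : Z.NonCrossing (X ⊓ Y) ∧ Z.NonCrossing (X ⊔ Y) := by
  by_cases hrt : r = t
  · subst hrt
    rcases hZ.le_or_le hX hZX with hleX | hgeX <;> rcases hZ.le_or_le hY hZY with hleY | hgeY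
    · exact ⟨.of_le (le_inf hleX hleY), .of_le (hleX.trans le_sup_left)⟩
    · exact absurd (.of_ge (hgeY.trans hleX)) hXY
    · exact absurd (.of_le (hgeX.trans hleY)) hXY
    · exact ⟨.of_ge (inf_le_left.trans hgeX), .of_ge (sup_le hgeX hgeY)⟩
  · have hdX := hZ.stronglyDisjoint hX hrt hZX
    have hdY := hZ.stronglyDisjoint hY hrt hZY
    exact ⟨(hdX.mono_right inf_le_left).nonCrossing, (hdX.sup_right hdY).nonCrossing⟩

theorem nonCrossing_diff (hZ : Z.HasUniqueTerminal T r) (hX : X.HasUniqueTerminal T s)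
    (hY : Y.HasUniqueTerminal T t) (hst : s ≠ t) (hZX : Z.NonCrossing X) (hZY : Z.NonCrossing Y) :
    Z.NonCrossing (X.diff Y) := by
  by_cases hrs : r = s
  · subst hrs
    rcases hZ.le_or_le hX hZX with hle | hge
    · exact .of_le ((hZ.stronglyDisjoint hY hst hZY).le_diff hle)
    · exact .of_ge (diff_le_left.trans hge)
  · exact ((hZ.stronglyDisjoint hX hrs hZX).mono_right diff_le_left).nonCrossing

end HasUniqueTerminal

end Terminals

end Biset

theorem exists_hasUniqueTerminal_of_mem_terminalBisets {V : Type*} [DecidableEq V] {T : Finset V}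
    {X : NonemptyBiset V} (hX : X ∈ terminalBisets T) : ∃ t, X.1.HasUniqueTerminal T t := by
  obtain ⟨t, ht, hinner, houter⟩ := Set.mem_iUnion₂.1 hX
  refine ⟨t, ht, ?_, fun s hs hsX => ?_⟩
  · exact (Finset.mem_inter.1 (hinner ▸ Finset.mem_singleton_self t)).1
  · exact Finset.mem_singleton.1 (houter ▸ Finset.mem_inter.2 ⟨hsX, hs⟩)

section Cuts

theorem dotProduct_eq_dotProduct_of_le {n R : Type*} [Fintype n] [Ring R] [PartialOrder R]
    [IsOrderedRing R] [NoZeroDivisors R] {a b x z : n → R} (hab : a ≤ b) (hx : 0 ≤ x)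
    (h : a ⬝ᵥ x = b ⬝ᵥ x) (hz : ∀ j, x j = 0 → z j = 0) : a ⬝ᵥ z = b ⬝ᵥ z := by
  have hterm : ∀ j ∈ Finset.univ, a j * x j ≤ b j * x j :=
    fun j _ => mul_le_mul_of_nonneg_right (hab j) (hx j)
  refine Finset.sum_congr rfl fun j hj => ?_
  rcases mul_eq_mul_right_iff.1 ((Finset.sum_eq_sum_iff_of_le hterm).1 h j hj) with heq | hxj
  · rw [heq]
  · rw [hz j hxj, mul_zero, mul_zero]

variable {V E : Type*} [Fintype E] {ends : E → Sym2 V} {X : Biset V} {a b : V} {e : E}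

/-- `X` separates the ordered pair `(a, b)`. An edge lies in `δ(X)` if `X` separates its end nodes
in one of the two orders. -/
def Biset.Separates (X : Biset V) (a b : V) : Prop :=
  a ∈ X.inner ∧ b ∉ X.outer

theorem mem_bisetCut_iff (he : ends e = s(a, b)) :
    e ∈ bisetCut ends X ↔ X.Separates a b ∨ X.Separates b a := by
  simp only [bisetCut, Finset.mem_filter, Finset.mem_univ, true_and, he, Sym2.eq_iff]
  constructor
  · rintro ⟨c, d, ⟨rfl, rfl⟩ | ⟨rfl, rfl⟩, hX⟩
    · exact Or.inl hX
    · exact Or.inr hX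
  · rintro (hX | hX)
    · exact ⟨a, b, Or.inl ⟨rfl, rfl⟩, hX⟩
    · exact ⟨b, a, Or.inr ⟨rfl, rfl⟩, hX⟩

open Classical in
/-- The incidence vector of `δ(X)`, so that `x(δ(X)) = cutVector ends X ⬝ᵥ x`. -/
noncomputable def cutVector (ends : E → Sym2 V) (X : Biset V) (e : E) : ℚ :=
  if e ∈ bisetCut ends X then 1 else 0

theorem cutVector_dotProduct (x : E → ℚ) :
    cutVector ends X ⬝ᵥ x = ∑ e ∈ bisetCut ends X, x e := by
  classical
  simp only [dotProduct, cutVector, ite_mul, one_mul, zero_mul, Finset.sum_ite_mem,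
    Finset.univ_inter]

theorem cutVector_bot : cutVector ends ⊥ = 0 := by
  ext e
  simp [cutVector, bisetCut, Biset.inner_bot]

theorem zero_le_cutVector : 0 ≤ cutVector ends X := fun e => by
  unfold cutVector
  split_ifs <;> simp

theorem cutVector_sub_mem_range_signType (X Y : Biset V) (e : E) :
    cutVector ends X e - cutVector ends Y e ∈ Set.range SignType.cast := by
  unfold cutVector
  split_ifs
  · exact ⟨0, by simp⟩
  · exact ⟨1, by simp⟩
  · exact ⟨-1, by simp⟩
  · exact ⟨0, by simp⟩

variable [DecidableEq V]

theorem cutVector_inf_add_sup_le (X Y : Biset V) :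
    cutVector ends (X ⊓ Y) + cutVector ends (X ⊔ Y) ≤ cutVector ends X + cutVector ends Y := by
  intro e
  obtain ⟨a, b, he⟩ : ∃ a b, ends e = s(a, b) := (ends e).ind fun a b => ⟨a, b, rfl⟩
  have haX := @X.inner_subset_outer a
  have hbX := @X.inner_subset_outer b
  have haY := @Y.inner_subset_outer a
  have hbY := @Y.inner_subset_outer b
  simp only [Pi.add_apply, cutVector, mem_bisetCut_iff he, Biset.Separates,
    Biset.inner_inf, Biset.outer_inf, Biset.inner_sup, Biset.outer_sup, Finset.mem_inter,
    Finset.mem_union]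
  grind

theorem cutVector_diff_add_diff_le (X Y : Biset V) :
    cutVector ends (X.diff Y) + cutVector ends (Y.diff X) ≤
      cutVector ends X + cutVector ends Y := by
  intro e
  obtain ⟨a, b, he⟩ : ∃ a b, ends e = s(a, b) := (ends e).ind fun a b => ⟨a, b, rfl⟩
  have haX := @X.inner_subset_outer a
  have hbX := @X.inner_subset_outer b
  have haY := @Y.inner_subset_outer a
  have hbY := @Y.inner_subset_outer b
  simp only [Pi.add_apply, cutVector, mem_bisetCut_iff he, Biset.Separates, Biset.diff,
    Finset.mem_sdiff]
  grind

end Cuts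

section Predecessor

variable {V : Type*} [DecidableEq V] {T : Finset V} {L : Finset (Biset V)} {X Y : Biset V} {a b : V}

namespace Biset

open Classical in
/-- The union of the proper subsets of `X` in the family `L`. If `L` is non-crossing and its
members have a unique terminal, these form a chain and this is its greatest element, or
`⊥ = (∅, ∅)` if the chain is empty. -/
noncomputable def predecessor (L : Finset (Biset V)) (X : Biset V) : Biset V :=
  {Y ∈ L | Y < X}.sup id

theorem predecessor_le : predecessor L X ≤ X := by
  classical
  exact Finset.sup_le fun Y hY => (Finset.mem_filter.1 hY).2.le

theorem le_predecessor (hY : Y ∈ L) (hYX : Y < X) : Y ≤ predecessor L X := by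
  classical
  exact Finset.le_sup (f := id) (Finset.mem_filter.2 ⟨hY, hYX⟩)

theorem predecessor_eq_bot_or_mem (hL : ∀ X ∈ L, ∃ t, X.HasUniqueTerminal T t)
    (hNC : (L : Set (Biset V)).Pairwise NonCrossing) (hX : X ∈ L) :
    predecessor L X = ⊥ ∨ predecessor L X ∈ L ∧ predecessor L X < X := by
  classical
  obtain ⟨t, ht⟩ := hL X hX
  have hterminal (Y : Biset V) (hY : Y ∈ L) (hYX : Y < X) : Y.HasUniqueTerminal T t := by
    obtain ⟨s, hs⟩ := hL Y hY
    exact hs.eq_of_le ht hYX.le ▸ hs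
  refine Finset.sup_mem {Y | Y = ⊥ ∨ Y ∈ L ∧ Y < X} (Or.inl rfl) ?_ _ _
    fun Y hY => Or.inr (Finset.mem_filter.1 hY)
  rintro Y (rfl | ⟨hY, hYX⟩) Z (rfl | ⟨hZ, hZX⟩)
  · exact Or.inl (sup_idem ⊥)
  · exact Or.inr ((bot_sup_eq Z).symm ▸ ⟨hZ, hZX⟩)
  · exact Or.inr ((sup_bot_eq Y).symm ▸ ⟨hY, hYX⟩)
  · rcases (hterminal Y hY hYX).le_or_le (hterminal Z hZ hZX)
      ((Set.pairwise_iff_of_refl.1 hNC) hY hZ) with hle | hle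
    · exact Or.inr ((sup_of_le_right hle).symm ▸ ⟨hZ, hZX⟩)
    · exact Or.inr ((sup_of_le_left hle).symm ▸ ⟨hY, hYX⟩)

theorem predecessor_induction (hL : ∀ X ∈ L, ∃ t, X.HasUniqueTerminal T t)
    (hNC : (L : Set (Biset V)).Pairwise NonCrossing) {P : Biset V → Prop} (bot : P ⊥)
    (step : ∀ X ∈ L, P (predecessor L X) → P X) (hX : X ∈ L) : P X := by
  suffices ∀ Y : L, P Y from this ⟨X, hX⟩
  intro Y
  induction Y using WellFoundedLT.induction with
  | ind Y ih =>
    refine step Y Y.2 ?_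
    rcases predecessor_eq_bot_or_mem hL hNC Y.2 with hbot | ⟨hmem, hlt⟩
    · exact hbot.symm ▸ bot
    · exact ih ⟨_, hmem⟩ hlt

/-- On passing from its predecessor in `L` to `X`, the node `a` comes in while `b` stays put:
either `X` starts to separate `a` from `b`, or the predecessor ceases to separate `b` from `a`. -/
def Absorbs (L : Finset (Biset V)) (a b : V) (X : Biset V) : Prop :=
  (X.Separates a b ∧ a ∉ (predecessor L X).inner) ∨
    ((predecessor L X).Separates b a ∧ a ∈ X.outer)

theorem Absorbs.mem_outer (h : Absorbs L a b X) : a ∈ X.outer :=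
  h.elim (fun hstart => X.inner_subset_outer hstart.1.1) And.right

theorem Absorbs.le_or_le (hX : Absorbs L a b X) (hY : Absorbs L a b Y) (hXY : X.NonCrossing Y) :
    X ≤ Y ∨ Y ≤ X := by
  have haX := hX.mem_outer
  have haY := hY.mem_outer
  rcases hY with hY | hY
  · exact hXY.le_or_le_of_mem haX hY.1.1
  rcases hX with hX | hX
  · exact (hXY.symm.le_or_le_of_mem haY hX.1.1).symm
  · exact hXY.le_or_le_of_mem (X.inner_subset_outer (predecessor_le.1 hX.1.1))
      (predecessor_le.1 hY.1.1)

theorem Absorbs.not_lt (hXL : X ∈ L) (hX : Absorbs L a b X) (hY : Absorbs L a b Y) :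
    ¬ X < Y := by
  intro hlt
  have hle := le_predecessor hXL hlt
  rcases hY with ⟨⟨-, hbY⟩, haY⟩ | ⟨⟨-, haY⟩, -⟩
  · rcases hX with ⟨⟨haX, -⟩, -⟩ | ⟨⟨hbX, -⟩, -⟩
    · exact haY (hle.1 haX)
    · exact hbY (hlt.le.2 (X.inner_subset_outer (predecessor_le.1 hbX)))
  · exact haY (hle.2 hX.mem_outer)

theorem Absorbs.eq (hNC : (L : Set (Biset V)).Pairwise NonCrossing) (hXL : X ∈ L) (hYL : Y ∈ L)
    (hX : Absorbs L a b X) (hY : Absorbs L a b Y) : X = Y := by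
  by_contra hne
  rcases hX.le_or_le hY (hNC hXL hYL hne) with hle | hle
  · exact hX.not_lt hXL hY (lt_of_le_of_ne hle hne)
  · exact hY.not_lt hYL hX (lt_of_le_of_ne hle (Ne.symm hne))

theorem absorbs_or_absorbs {E : Type*} [Fintype E] {ends : E → Sym2 V} {e : E}
    (he : ends e = s(a, b)) (hne : cutVector ends X e - cutVector ends (predecessor L X) e ≠ 0) :
    Absorbs L a b X ∨ Absorbs L b a X := by
  have hainner := @(predecessor_le (L := L) (X := X)).1 a
  have hbinner := @(predecessor_le (L := L) (X := X)).1 b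
  have haouter := @(predecessor_le (L := L) (X := X)).2 a
  have hbouter := @(predecessor_le (L := L) (X := X)).2 b
  simp only [cutVector, mem_bisetCut_iff he, Separates] at hne
  grind [Absorbs, Separates]

theorem card_cutVector_sub_predecessor_ne_zero_le_two {E : Type*} [Fintype E]
    (ends : E → Sym2 V) (hNC : (L : Set (Biset V)).Pairwise NonCrossing) (e : E) :
    #{X : L | cutVector ends X e - cutVector ends (predecessor L X) e ≠ 0} ≤ 2 := by
  classical
  obtain ⟨a, b, he⟩ : ∃ a b, ends e = s(a, b) := (ends e).ind fun a b => ⟨a, b, rfl⟩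
  have hone (c d : V) : #{X : L | Absorbs L c d X} ≤ 1 :=
    Finset.card_le_one.2 fun X hX Y hY => Subtype.ext <|
      (Finset.mem_filter.1 hX).2.eq hNC X.2 Y.2 (Finset.mem_filter.1 hY).2
  calc #{X : L | cutVector ends X e - cutVector ends (predecessor L X) e ≠ 0}
    _ ≤ #{X : L | Absorbs L a b X ∨ Absorbs L b a X} :=
      Finset.card_le_card (Finset.monotone_filter_right _ fun X _ => absorbs_or_absorbs he)
    _ ≤ #{X : L | Absorbs L a b X} + #{X : L | Absorbs L b a X} := by
      rw [Finset.filter_or]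
      exact Finset.card_union_le _ _
    _ ≤ 2 := add_le_add (hone a b) (hone b a)

end Biset

end Predecessor

section TightBisets

theorem exists_maximal_pairwise {α : Type*} [Finite α] (P : α → Prop) (r : α → α → Prop)
    [Std.Refl r] [Std.Symm r] :
    ∃ L : Finset α, (∀ a ∈ L, P a) ∧ (L : Set α).Pairwise r ∧
      ∀ a, P a → (∀ b ∈ L, r a b) → a ∈ L := by
  classical
  obtain ⟨L, hL⟩ := (Set.toFinite {L : Finset α | (∀ a ∈ L, P a) ∧ (L : Set α).Pairwise r})
    |>.exists_maximal ⟨∅, by simp⟩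
  refine ⟨L, hL.prop.1, hL.prop.2, fun a ha haL => ?_⟩
  refine hL.le_of_ge (y := insert a L) ⟨?_, ?_⟩ (Finset.subset_insert a L)
    (Finset.mem_insert_self a L)
  · exact Finset.forall_mem_insert .. |>.2 ⟨ha, hL.prop.1⟩
  · rw [Finset.coe_insert]
    exact hL.prop.2.insert_of_symm fun b hb _ => haL b hb

namespace BisetFunction

section Value

variable {V : Type*} {h : BisetFunction V} {X Y : Biset V}

theorem value_coe (h : BisetFunction V) (X : NonemptyBiset V) : h.value X.1 = h X :=
  dif_pos X.2

theorem exists_coe_of_value_pos (hX : 0 < h.value X) : ∃ Y : NonemptyBiset V, Y.1 = X := by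
  unfold value at hX
  split_ifs at hX with hne
  exacts [⟨⟨X, hne⟩, rfl⟩, absurd hX (lt_irrefl 0)]

theorem IntegerValued.exists_value_eq (hint : h.IntegerValued) (X : Biset V) :
    ∃ k : ℤ, h.value X = k := by
  unfold value
  split_ifs with hne
  exacts [hint ⟨X, hne⟩, ⟨0, Int.cast_zero.symm⟩]

theorem value_nonpos_of_not_hasUniqueTerminal {T : Finset V}
    (hterminal : ∀ Z : Biset V, 0 < h.value Z → ∃ r, Z.HasUniqueTerminal T r)
    (hX : ∀ r, ¬ X.HasUniqueTerminal T r) : h.value X ≤ 0 :=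
  not_lt.1 fun hlt => (hterminal X hlt).elim hX

variable [DecidableEq V] {T : Finset V}

theorem exists_hasUniqueTerminal_of_value_pos
    (hpos : ∀ X : NonemptyBiset V, 0 < h X → X ∈ terminalBisets T) (hX : 0 < h.value X) :
    ∃ t, X.HasUniqueTerminal T t := by
  obtain ⟨X, rfl⟩ := exists_coe_of_value_pos hX
  exact exists_hasUniqueTerminal_of_mem_terminalBisets (hpos X (value_coe h X ▸ hX))

theorem SkewSupermodular.value_add_value_le (hskew : h.SkewSupermodular) (hX : 0 < h.value X)
    (hY : 0 < h.value Y) :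
    h.value X + h.value Y ≤ h.value (X ⊓ Y) + h.value (X ⊔ Y) ∨
      h.value X + h.value Y ≤ h.value (X.diff Y) + h.value (Y.diff X) := by
  obtain ⟨X, rfl⟩ := exists_coe_of_value_pos hX
  obtain ⟨Y, rfl⟩ := exists_coe_of_value_pos hY
  rw [value_coe] at hX hY
  rw [value_coe, value_coe]
  exact hskew X Y hX hY

variable {s t : V} (hterminal : ∀ Z : Biset V, 0 < h.value Z → ∃ r, Z.HasUniqueTerminal T r)
include hterminal

theorem SkewSupermodular.value_add_value_le_inf_sup (hskew : h.SkewSupermodular)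
    (hX : 0 < h.value X) (hY : 0 < h.value Y) (hXt : X.HasUniqueTerminal T t)
    (hYt : Y.HasUniqueTerminal T t) :
    h.value X + h.value Y ≤ h.value (X ⊓ Y) + h.value (X ⊔ Y) := by
  refine (hskew.value_add_value_le hX hY).resolve_right fun hdiff => ?_
  have hXY := value_nonpos_of_not_hasUniqueTerminal hterminal fun _ => hXt.not_diff hYt
  have hYX := value_nonpos_of_not_hasUniqueTerminal hterminal fun _ => hYt.not_diff hXt
  linarith

theorem SkewSupermodular.value_add_value_le_diff (hskew : h.SkewSupermodular)
    (hX : 0 < h.value X) (hY : 0 < h.value Y) (hXs : X.HasUniqueTerminal T s)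
    (hYt : Y.HasUniqueTerminal T t) (hst : s ≠ t) :
    h.value X + h.value Y ≤ h.value (X.diff Y) + h.value (Y.diff X) := by
  refine (hskew.value_add_value_le hX hY).resolve_left fun hinfsup => ?_
  have hinf := value_nonpos_of_not_hasUniqueTerminal hterminal fun _ => hXs.not_inf hYt hst
  have hsup := value_nonpos_of_not_hasUniqueTerminal hterminal fun _ => hXs.not_sup hYt hst
  linarith

theorem SkewSupermodular.exists_uncrossing {E : Type*} [Fintype E] (ends : E → Sym2 V)
    (hskew : h.SkewSupermodular) (hX : 0 < h.value X) (hY : 0 < h.value Y)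
    (hXY : ¬ X.NonCrossing Y) :
    ∃ A B : Biset V, h.value X + h.value Y ≤ h.value A + h.value B ∧
      cutVector ends A + cutVector ends B ≤ cutVector ends X + cutVector ends Y ∧
      (Y.NonCrossing A ∧ Y.NonCrossing B) ∧
      ∀ (Z : Biset V) (r : V), Z.HasUniqueTerminal T r → Z.NonCrossing X →
        Z.NonCrossing Y → Z.NonCrossing A ∧ Z.NonCrossing B := by
  obtain ⟨s, hs⟩ := hterminal X hX
  obtain ⟨t, ht⟩ := hterminal Y hY
  by_cases hst : s = t
  · subst hst
    exact ⟨X ⊓ Y, X ⊔ Y, hskew.value_add_value_le_inf_sup hterminal hX hY hs ht,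
      cutVector_inf_add_sup_le X Y, ⟨.of_ge inf_le_right, .of_le le_sup_right⟩,
      fun _ _ hZ hZX hZY => hZ.nonCrossing_inf_and_sup hs ht hXY hZX hZY⟩
  · exact ⟨X.diff Y, Y.diff X, hskew.value_add_value_le_diff hterminal hX hY hs ht hst,
      cutVector_diff_add_diff_le X Y,
      ⟨Biset.stronglyDisjoint_diff.nonCrossing, .of_ge Biset.diff_le_left⟩,
      fun _ _ hZ hZX hZY => ⟨hZ.nonCrossing_diff hs ht hst hZX hZY,
        hZ.nonCrossing_diff ht hs (Ne.symm hst) hZY hZX⟩⟩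

end Value

variable {V E : Type*} [Fintype E] {ends : E → Sym2 V} {h : BisetFunction V} {u : E → ℕ}
  {x z : E → ℚ} {X Y A B : Biset V}

theorem value_le_of_mem_coverPolyhedron (hx : x ∈ coverPolyhedron ends h u) (X : Biset V) :
    h.value X ≤ (cutVector ends X ⬝ᵥ x : ℚ) := by
  rw [cutVector_dotProduct]
  unfold value
  split_ifs with hne
  · exact hx.2.1 ⟨X, hne⟩
  · exact_mod_cast Finset.sum_nonneg fun e _ => hx.1 e

/-- The covering constraint of `X` holds with equality at `x`. -/
def IsTight (ends : E → Sym2 V) (h : BisetFunction V) (x : E → ℚ) (X : Biset V) : Prop :=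
  h.value X = (cutVector ends X ⬝ᵥ x : ℚ)

theorem IsTight.dotProduct_mem_int (hX : IsTight ends h x X) (hint : h.IntegerValued) :
    cutVector ends X ⬝ᵥ x ∈ (Int.castRingHom ℚ).range := by
  obtain ⟨k, hk⟩ := hint.exists_value_eq X
  exact ⟨k, by exact_mod_cast hk.symm.trans hX⟩

theorem IsTight.dotProduct_eq_zero (hX : IsTight ends h x X) (hx : x ∈ coverPolyhedron ends h u)
    (hz : ∀ e, x e = 0 → z e = 0) (hle : h.value X ≤ 0) : cutVector ends X ⬝ᵥ z = 0 := by
  have hxX : cutVector ends X ⬝ᵥ x = 0 := by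
    refine le_antisymm ?_ (dotProduct_nonneg_of_nonneg zero_le_cutVector hx.1)
    exact_mod_cast hX ▸ hle
  rw [← zero_dotProduct z]
  exact (dotProduct_eq_dotProduct_of_le zero_le_cutVector hx.1
    ((zero_dotProduct x).trans hxX.symm) hz).symm

theorem IsTight.uncross (hX : IsTight ends h x X) (hY : IsTight ends h x Y)
    (hx : x ∈ coverPolyhedron ends h u) (hval : h.value X + h.value Y ≤ h.value A + h.value B)
    (hcut : cutVector ends A + cutVector ends B ≤ cutVector ends X + cutVector ends Y) :
    (IsTight ends h x A ∧ IsTight ends h x B) ∧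
      (cutVector ends A + cutVector ends B) ⬝ᵥ x = (cutVector ends X + cutVector ends Y) ⬝ᵥ x := by
  have hA := value_le_of_mem_coverPolyhedron hx A
  have hB := value_le_of_mem_coverPolyhedron hx B
  have hle := dotProduct_le_dotProduct_of_nonneg_right hcut hx.1
  unfold IsTight at *
  simp only [add_dotProduct] at hle ⊢
  have hle' : ((cutVector ends A ⬝ᵥ x : ℚ) : ℝ) + (cutVector ends B ⬝ᵥ x : ℚ) ≤
      (cutVector ends X ⬝ᵥ x : ℚ) + (cutVector ends Y ⬝ᵥ x : ℚ) := by exact_mod_cast hle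
  refine ⟨⟨by linarith, by linarith⟩, le_antisymm hle ?_⟩
  have hge : ((cutVector ends X ⬝ᵥ x : ℚ) : ℝ) + (cutVector ends Y ⬝ᵥ x : ℚ) ≤
      (cutVector ends A ⬝ᵥ x : ℚ) + (cutVector ends B ⬝ᵥ x : ℚ) := by linarith
  exact_mod_cast hge

/-- By induction on the number of members of `L` that cross the tight biset: uncrossing it with
one of them produces two bisets that cross fewer members. -/
theorem IsTight.dotProduct_eq_zero_of_maximal [DecidableEq V] {T : Finset V} {L : Finset (Biset V)}
    (hX : IsTight ends h x X) (hXpos : 0 < h.value X)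
    (hterminal : ∀ Z : Biset V, 0 < h.value Z → ∃ r, Z.HasUniqueTerminal T r)
    (hskew : h.SkewSupermodular) (hx : x ∈ coverPolyhedron ends h u)
    (hL : ∀ Y ∈ L, 0 < h.value Y ∧ IsTight ends h x Y)
    (hNC : (L : Set (Biset V)).Pairwise Biset.NonCrossing)
    (hmax : ∀ Y, 0 < h.value Y ∧ IsTight ends h x Y → (∀ Z ∈ L, Y.NonCrossing Z) → Y ∈ L)
    (hz : ∀ e, x e = 0 → z e = 0) (hzL : ∀ Y ∈ L, cutVector ends Y ⬝ᵥ z = 0) :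
    cutVector ends X ⬝ᵥ z = 0 := by
  classical
  induction hn : #{Z ∈ L | ¬ Z.NonCrossing X} using Nat.strong_induction_on generalizing X with
  | _ n ih =>
  by_cases hcross : ∀ Y ∈ L, X.NonCrossing Y
  · exact hzL X (hmax X ⟨hXpos, hX⟩ hcross)
  push Not at hcross
  obtain ⟨Y, hYL, hXY⟩ := hcross
  obtain ⟨hYpos, hY⟩ := hL Y hYL
  obtain ⟨A, B, hval, hcut, ⟨hYA, hYB⟩, hAB⟩ :=
    hskew.exists_uncrossing hterminal ends hXpos hYpos hXY
  obtain ⟨⟨hA, hB⟩, heq⟩ := hX.uncross hY hx hval hcut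
  have hABL (Z : Biset V) (hZ : Z ∈ L) (hZX : Z.NonCrossing X) :
      Z.NonCrossing A ∧ Z.NonCrossing B := by
    obtain ⟨r, hr⟩ := hterminal Z (hL Z hZ).1
    exact hAB Z r hr hZX ((Set.pairwise_iff_of_refl.1 hNC) hZ hYL)
  have hfewer (C : Biset V) (hC : IsTight ends h x C) (hYC : Y.NonCrossing C)
      (hCL : ∀ Z ∈ L, Z.NonCrossing X → Z.NonCrossing C) : cutVector ends C ⬝ᵥ z = 0 := by
    rcases le_or_gt (h.value C) 0 with hle | hCpos
    · exact hC.dotProduct_eq_zero hx hz hle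
    refine ih _ ?_ hC hCpos rfl
    rw [← hn]
    refine Finset.card_lt_card (Finset.ssubset_iff_of_subset ?_ |>.2 ⟨Y, ?_, ?_⟩)
    · exact Finset.monotone_filter_right L fun Z hZ hZC hZX => hZC (hCL Z hZ hZX)
    · exact Finset.mem_filter.2 ⟨hYL, fun hYX => hXY hYX.symm⟩
    · exact fun hmem => (Finset.mem_filter.1 hmem).2 hYC
  have hzAB := dotProduct_eq_dotProduct_of_le hcut hx.1 heq hz
  rw [add_dotProduct, add_dotProduct, hfewer A hA hYA fun Z hZ hZX => (hABL Z hZ hZX).1,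
    hfewer B hB hYB fun Z hZ hZX => (hABL Z hZ hZX).2, hzL Y hYL] at hzAB
  simpa only [add_zero] using hzAB.symm

end BisetFunction

end TightBisets

section ExtremePoints

section OrderedField

variable {𝕜 : Type*} [Field 𝕜] [LinearOrder 𝕜] [IsStrictOrderedRing 𝕜]

theorem eq_zero_of_mem_openSegment_of_nonneg {n : Type*} {x a b : n → 𝕜} (ha : 0 ≤ a) (hb : 0 ≤ b)
    (hx : x ∈ openSegment 𝕜 a b) {j : n} (hxj : x j = 0) : a j = 0 ∧ b j = 0 := by
  obtain ⟨s, t, hs, ht, -, rfl⟩ := hx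
  have hsum := (add_eq_zero_iff_of_nonneg (mul_nonneg hs.le (ha j)) (mul_nonneg ht.le (hb j))).1 hxj
  exact ⟨(mul_eq_zero_iff_left hs.ne').1 hsum.1, (mul_eq_zero_iff_left ht.ne').1 hsum.2⟩

variable [TopologicalSpace 𝕜] [OrderTopology 𝕜]

theorem eq_zero_of_eventually_add_smul_mem {M : Type*} [AddCommGroup M] [Module 𝕜 M] {S : Set M}
    {x z : M} (hx : x ∈ S.extremePoints 𝕜) (hz : ∀ᶠ ε : 𝕜 in 𝓝 0, x + ε • z ∈ S) : z = 0 := by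
  have hneg : ∀ᶠ ε : 𝕜 in 𝓝 0, x + (-ε) • z ∈ S :=
    (continuous_neg.tendsto' (0 : 𝕜) 0 neg_zero).eventually hz
  have hball : ∀ᶠ ε : 𝕜 in 𝓝[≠] 0, x + ε • z ∈ S ∧ x + (-ε) • z ∈ S :=
    (hz.and hneg).filter_mono nhdsWithin_le_nhds
  obtain ⟨ε, ⟨hadd, hsub⟩, hε⟩ := (hball.and self_mem_nhdsWithin).exists
  have hmid : x ∈ openSegment 𝕜 (x + ε • z) (x + (-ε) • z) :=
    ⟨1 / 2, 1 / 2, one_half_pos, one_half_pos, add_halves 1, by module⟩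
  exact (smul_eq_zero.1 (add_eq_left.1 (hx.2 hadd hsub hmid))).resolve_left hε

end OrderedField

theorem eventually_le_of_eq_imp {α R : Type*} [TopologicalSpace α] [TopologicalSpace R]
    [LinearOrder R] [OrderClosedTopology R] {f g : α → R} {a : α} (hf : Continuous f)
    (hg : Continuous g) (hle : f a ≤ g a) (heq : f a = g a → ∀ t, f t ≤ g t) :
    ∀ᶠ t in 𝓝 a, f t ≤ g t := by
  rcases hle.eq_or_lt with hfg | hlt
  · exact .of_forall (heq hfg)
  · exact (hf.continuousAt.eventually_lt hg.continuousAt hlt).mono fun _ => le_of_lt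

variable {V E : Type*} [Fintype E] {ends : E → Sym2 V} {h : BisetFunction V} {u : E → ℕ}
  {x w : E → ℚ}

theorem eq_zero_of_mem_extremePoints_coverPolyhedron [Finite V] {z : E → ℚ}
    (hx : x ∈ (coverPolyhedron ends h u).extremePoints ℚ) (hz0 : ∀ e, x e = 0 → z e = 0)
    (hzu : ∀ e, x e = u e → z e = 0)
    (hzX : ∀ X, h.IsTight ends x X → cutVector ends X ⬝ᵥ z = 0) : z = 0 := by
  obtain ⟨hnonneg, hcover, hupper⟩ := hx.1
  refine eq_zero_of_eventually_add_smul_mem hx ?_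
  have hcoord (e : E) : Continuous fun ε : ℚ => (x + ε • z) e := by
    simp only [Pi.add_apply, Pi.smul_apply, smul_eq_mul]
    fun_prop
  refine .and (Filter.eventually_all.2 fun e => ?_) <|
    .and (Filter.eventually_all.2 fun X => ?_) (Filter.eventually_all.2 fun e => ?_)
  · refine eventually_le_of_eq_imp continuous_const (hcoord e) (by simpa using hnonneg e) ?_
    intro h0 ε
    simp only [zero_smul, add_zero] at h0
    simpa [hz0 e h0.symm] using hnonneg e
  · simp only [← cutVector_dotProduct] at hcover ⊢
    have hcut : Continuous fun ε : ℚ => ((cutVector ends X.1 ⬝ᵥ (x + ε • z) : ℚ) : ℝ) :=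
      Rat.continuous_coe_real.comp (continuous_const.dotProduct (continuous_pi hcoord))
    refine eventually_le_of_eq_imp continuous_const hcut (by simpa using hcover X) ?_
    intro htight ε
    simp only [zero_smul, add_zero] at htight
    have hzero := hzX X.1 ((BisetFunction.value_coe h X).trans htight)
    simpa [dotProduct_add, dotProduct_smul, hzero] using hcover X
  · refine eventually_le_of_eq_imp (hcoord e) continuous_const (by simpa using hupper e) ?_
    intro hu ε
    simp only [zero_smul, add_zero] at hu
    simpa [hzu e hu] using hupper e

theorem exists_eq_div_two_of_mem_extremePoints_coverPolyhedron [Finite V] [DecidableEq V]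
    {T : Finset V} (hterminal : ∀ X : Biset V, 0 < h.value X → ∃ t, X.HasUniqueTerminal T t)
    (hskew : h.SkewSupermodular) (hint : h.IntegerValued)
    (hx : x ∈ (coverPolyhedron ends h u).extremePoints ℚ) (e : E) :
    ∃ k : ℤ, x e = k / 2 := by
  obtain ⟨L, hL, hNC, hmax⟩ := exists_maximal_pairwise
    (fun X : Biset V => 0 < h.value X ∧ h.IsTight ends x X) Biset.NonCrossing
  have hLT (X : Biset V) (hX : X ∈ L) := hterminal X (hL X hX).1
  let A : Matrix L E ℚ := fun X => cutVector ends X - cutVector ends (X.1.predecessor L)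
  have hmulVec (z : E → ℚ) (X : L) :
      A.mulVec z X = cutVector ends X ⬝ᵥ z - cutVector ends (X.1.predecessor L) ⬝ᵥ z :=
    sub_dotProduct ..
  refine exists_eq_div_two_of_integral_system (A := A)
    (fun _ _ => cutVector_sub_mem_range_signType ..)
    (Biset.card_cutVector_sub_predecessor_ne_zero_le_two ends hNC) (fun X => ?_)
    (fun z hz hAz => ?_) e
  · rw [hmulVec]
    refine sub_mem ((hL X X.2).2.dotProduct_mem_int hint) ?_
    rcases Biset.predecessor_eq_bot_or_mem hLT hNC X.2 with hbot | ⟨hmem, -⟩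
    · rw [hbot, cutVector_bot, zero_dotProduct]
      exact zero_mem _
    · exact (hL _ hmem).2.dotProduct_mem_int hint
  · have hzL (X : Biset V) (hX : X ∈ L) : cutVector ends X ⬝ᵥ z = 0 := by
      refine Biset.predecessor_induction (P := fun X => cutVector ends X ⬝ᵥ z = 0) hLT hNC ?_
        (fun X hX hpred => ?_) hX
      · rw [cutVector_bot, zero_dotProduct]
      · rw [← hpred, ← sub_eq_zero, ← hmulVec z ⟨X, hX⟩, hAz, Pi.zero_apply]
    have hz0 (e : E) (he : x e = 0) : z e = 0 := hz e ⟨0, by simp [he]⟩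
    have hzu (e : E) (he : x e = u e) : z e = 0 := hz e ⟨u e, by simp [he]⟩
    refine eq_zero_of_mem_extremePoints_coverPolyhedron hx hz0 hzu fun X hX => ?_
    rcases le_or_gt (h.value X) 0 with hXle | hXpos
    · exact hX.dotProduct_eq_zero hx.1 hz0 hXle
    · exact hX.dotProduct_eq_zero_of_maximal hXpos hterminal hskew hx.1 hL hNC hmax hz0 hzL

theorem residualFunction_le_iff {y : E → ℚ} {X : NonemptyBiset V} :
    residualFunction ends h y X ≤ ((∑ e ∈ bisetCut ends X.1, w e : ℚ) : ℝ) ↔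
      h X ≤ ((∑ e ∈ bisetCut ends X.1, (y + w) e : ℚ) : ℝ) := by
  simp only [residualFunction, Pi.add_apply, Finset.sum_add_distrib, Rat.cast_add,
    sub_le_iff_le_add']

theorem fract_mem_coverPolyhedron_residual (hx : x ∈ coverPolyhedron ends h u) :
    Int.fract ∘ x ∈
      coverPolyhedron ends (residualFunction ends h fun e => (⌊x e⌋ : ℚ)) fun _ => 1 := by
  refine ⟨fun e => Int.fract_nonneg (x e), fun X => residualFunction_le_iff.2 ?_, fun e => ?_⟩
  · simpa only [Pi.add_apply, Function.comp_apply, Int.floor_add_fract] using hx.2.1 X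
  · exact_mod_cast (Int.fract_lt_one (x e)).le

theorem floor_add_mem_coverPolyhedron (hx : x ∈ coverPolyhedron ends h u)
    (hw : w ∈ coverPolyhedron ends (residualFunction ends h fun e => (⌊x e⌋ : ℚ)) fun _ => 1)
    (hw0 : ∀ e, Int.fract (x e) = 0 → w e = 0) :
    (fun e => (⌊x e⌋ : ℚ)) + w ∈ coverPolyhedron ends h u := by
  refine ⟨fun e => ?_, fun X => residualFunction_le_iff.1 (hw.2.1 X), fun e => ?_⟩
  · exact add_nonneg (Int.cast_nonneg (Int.floor_nonneg.2 (hx.1 e))) (hw.1 e)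
  · rcases eq_or_ne (Int.fract (x e)) 0 with hfract | hfract
    · rw [Pi.add_apply, hw0 e hfract, add_zero]
      exact (Int.floor_le (x e)).trans (hx.2.2 e)
    · have hlt : (⌊x e⌋ : ℚ) < u e :=
        (lt_of_le_of_ne (Int.floor_le _) fun heq => hfract (sub_eq_zero.2 heq.symm)).trans_le
          (hx.2.2 e)
      have hle : (⌊x e⌋ : ℚ) + 1 ≤ u e := by exact_mod_cast hlt
      exact (add_le_add_right (by exact_mod_cast hw.2.2 e) _).trans hle

theorem fract_mem_extremePoints_coverPolyhedron_residual
    (hx : x ∈ (coverPolyhedron ends h u).extremePoints ℚ) :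
    Int.fract ∘ x ∈ (coverPolyhedron ends (residualFunction ends h fun e => (⌊x e⌋ : ℚ))
      fun _ => 1).extremePoints ℚ := by
  refine ⟨fract_mem_coverPolyhedron_residual hx.1, fun a ha b hb hab => ?_⟩
  have hzero (e : E) (he : Int.fract (x e) = 0) : a e = 0 ∧ b e = 0 :=
    eq_zero_of_mem_openSegment_of_nonneg ha.1 hb.1 hab he
  have hsplit : (fun e => (⌊x e⌋ : ℚ)) + Int.fract ∘ x = x :=
    funext fun e => Int.floor_add_fract (x e)
  have hlift := (mem_openSegment_translate ℚ fun e => (⌊x e⌋ : ℚ)).2 hab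
  rw [hsplit] at hlift
  refine add_left_cancel ((hx.2 ?_ ?_ hlift).trans hsplit.symm)
  · exact floor_add_mem_coverPolyhedron hx.1 ha fun e he => (hzero e he).1
  · exact floor_add_mem_coverPolyhedron hx.1 hb fun e he => (hzero e he).2

end ExtremePoints

theorem mainTheorem3 {V E : Type*} [Fintype V] [DecidableEq V] [Fintype E]
    (ends : E → Sym2 V) (T : Finset V) (h : BisetFunction V)
    (hskew : h.SkewSupermodular)
    (hpos : ∀ X : NonemptyBiset V, 0 < h X → X ∈ terminalBisets T)
    (u : E → ℕ) :
    (∀ x ∈ Set.extremePoints ℚ (coverPolyhedron ends h u),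
      (fun e => x e - (⌊x e⌋ : ℚ)) ∈
        Set.extremePoints ℚ
          (coverPolyhedron ends (residualFunction ends h fun e => (⌊x e⌋ : ℚ)) fun _ => 1)) ∧
    (h.IntegerValued →
      ∀ x ∈ Set.extremePoints ℚ (coverPolyhedron ends h u),
        ∀ e : E, ∃ k : ℤ, x e = (k : ℚ) / 2) :=
  ⟨fun _ hx => fract_mem_extremePoints_coverPolyhedron_residual hx, fun hint _ hx e =>
    exists_eq_div_two_of_mem_extremePoints_coverPolyhedron
      (fun _ => BisetFunction.exists_hasUniqueTerminal_of_value_pos hpos) hskew hint hx e⟩
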